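/- All graphs are finite, simple and undirected, and $\log$ is the natural logarithm. For a graph $G$ and a vertex $v$ let $N[v]$ be the closed neighborhood of $v$, that is, $v$ together with its neighbors. A set $C\subseteq V(G)$ is an identifying code of $G$ if it is dominating (every vertex outside $C$ has a neighbor in $C$) and separating ($N[u]\cap C\neq N[v]\cap C$ for all distinct vertices $u,v$). The identifying code number $\gamma^{\mathrm{ID}}(G)$ is the minimum size of an identifying code of $G$ (and $\gamma^{\mathrm{ID}}(G)=\infty$ if there is none). Theorem. Let $\omega:\mathbb{N}\to\mathbb{R}$ be a function with $\omega(n)\to\infty$ as $n\to\infty$. Then there is an $n_0$, depending only on $\omega$, such that for every $n\ge n_0$ and every graph $G$ on $n$ vertices with maximum degree $\Delta\ge\omega(n)$ and minimum degree $\delta\ge 66\log\Delta$, there is a set of edges $F\subseteq E(G)$ of size $$|F|\le 83\,n\log\Delta$$ such that $G\setminus F$, the spanning subgraph of $G$ obtained by deleting the edges of $F$, has an identifying code and $$\gamma^{\mathrm{ID}}(G\setminus F)\le 134\,\frac{n\log\Delta}{\delta}.$$ -/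

import Mathlib

open Filter

namespace SimpleGraph

universe u

variable {V : Type u}

/-- The closed neighborhood `N[v] = N(v) ∪ {v}` of a vertex `v`. -/
def closedNbhd (G : SimpleGraph V) (v : V) : Set V :=
  insert v (G.neighborSet v)

/-- `C` is a dominating set: each vertex outside `C` has at least one neighbor in `C`. -/
def IsDominatingCode (G : SimpleGraph V) (C : Set V) : Prop :=
  ∀ v, v ∉ C → ∃ w ∈ C, G.Adj v w

/-- `C` is a separating set: distinct vertices have distinct traces of their closed
neighborhoods on `C`. -/
def IsSeparatingCode (G : SimpleGraph V) (C : Set V) : Prop :=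
  ∀ u v, u ≠ v → G.closedNbhd u ∩ C ≠ G.closedNbhd v ∩ C

/-- An identifying code is a set of vertices that is both dominating and separating. -/
def IsIdentifyingCode (G : SimpleGraph V) (C : Set V) : Prop :=
  G.IsDominatingCode C ∧ G.IsSeparatingCode C

/-- The identifying code number: the minimum size of an identifying code, as an extended natural
number; it is `⊤` if there is no identifying code (or only infinite ones). -/
noncomputable def identifyingCodeNumber (G : SimpleGraph V) : ℕ∞ :=
  ⨅ C ∈ {C : Set V | G.IsIdentifyingCode C}, C.encard

end SimpleGraph

/-!
A random code is turned into an identifying code by deleting edges, with no use of the local lemma.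

Write `L = log Δ` and `k = ⌈3 L⌉`. Each vertex gets a uniform color in `ZMod 3` and joins `C` with
probability `p = 66 L / δ`. A vertex is *bad* if in some color it has fewer than `k` neighbors in
`C`. By an exponential-moment bound a vertex is bad with probability at most
`3 * 2 ^ k * (1 - p / 6) ^ δ ≤ 3 Δ⁻⁷`, so averaging gives an outcome in which
`|C| + Δ |B| ≤ 67 n L / δ`, where `B` is the set of bad vertices (`exists_coloring_code`).

The code is `C ∪ B`. Every good vertex `v` of color `i` owns a set `S v` of exactly `k` code
neighbors of color `i + 1`, and it may delete some of its edges to `S v`; at a bad vertex all edges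
are deleted except those from a good vertex of color `i` to a bad vertex of color `i + 1`. Cyclic
colors ensure that on `S v`
* the trace of `v` is decided by `v` alone,
* the trace of a vertex of color `i + 1` is not affected by any good vertex's deletions, because
  owned edges join different colors,
* the trace of another good vertex `u` of color `i` is decided by `u` alone.

Hence the good vertices can choose the kept parts `T v ⊆ S v` one after the other: each has to avoid
the empty set and the traces on `S v` of the `O(k Δ)` vertices whose closed neighborhood meets
`S v`, and there are `2 ^ k ≥ Δ ^ 2` subsets to choose from (`exists_greedy_choice`). Two vertices
whose colors agree, or are consecutive, are then separated, and in `ZMod 3` there are no other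
pairs. A bad vertex lies in its own trace, and every other trace that contains it belongs to a good
vertex of the preceding color (`isIdentifyingCode_removeArcs`). At most `Δ |B| + n k` edges are lost.
-/

namespace SimpleGraph

/-! ### Averaging and greedy choice -/

/-- First-moment method for independent choices `f v` with common distribution `w`: some outcome
does not exceed the expectation of a linear combination of products of functions of the single
coordinates. -/
theorem exists_sum_prod_le {V α J : Type*} [Fintype V] [DecidableEq V] [Fintype α] [Fintype J]
    (w : α → ℝ) (hw : ∀ a, 0 ≤ w a) (hw1 : ∑ a, w a = 1) (κ : J → ℝ)
    (g : J → V → α → ℝ) :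
    ∃ f : V → α, ∑ j, κ j * ∏ v, g j v (f v) ≤ ∑ j, κ j * ∏ v, ∑ a, w a * g j v a := by
  by_contra! h
  have h1 : ∑ f : V → α, ∏ v, w (f v) = 1 := by
    have := Finset.prod_univ_sum (fun _ : V => (Finset.univ : Finset α)) (fun _ a => w a)
    simpa [hw1] using this.symm
  have h2 : ∑ j, κ j * ∏ v, ∑ a, w a * g j v a
      = ∑ f : V → α, (∏ v, w (f v)) * ∑ j, κ j * ∏ v, g j v (f v) := by
    simp_rw [Finset.mul_sum, mul_left_comm _ (κ _), ← Finset.prod_mul_distrib]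
    rw [Finset.sum_comm]
    refine Finset.sum_congr rfl fun j _ => ?_
    rw [← Finset.mul_sum]
    congr 1
    have := Finset.prod_univ_sum (fun _ : V => (Finset.univ : Finset α))
      (fun v a => w a * g j v a)
    simpa using this
  have hnn : ∀ f : V → α, 0 ≤ ∏ v, w (f v) := fun f => Finset.prod_nonneg fun v _ => hw _
  set E := ∑ j, κ j * ∏ v, ∑ a, w a * g j v a with hE
  have h3 : ∑ f : V → α, (∏ v, w (f v)) * E = E := by rw [← Finset.sum_mul, h1, one_mul]
  obtain ⟨f, -, hf⟩ : ∃ f ∈ (Finset.univ : Finset (V → α)), 0 < ∏ v, w (f v) := by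
    apply Finset.exists_lt_of_sum_lt
    simp [h1]
  have h4 : ∑ f : V → α, (∏ v, w (f v)) * E
      < ∑ f : V → α, (∏ v, w (f v)) * ∑ j, κ j * ∏ v, g j v (f v) :=
    Finset.sum_lt_sum (fun f _ => mul_le_mul_of_nonneg_left (h f).le (hnn f))
      ⟨f, Finset.mem_univ _, mul_lt_mul_of_pos_left (h f) hf⟩
  rw [h3, ← h2] at h4
  exact lt_irrefl _ h4

/-- Values `T v` are chosen one vertex at a time, `v` avoiding its fixed forbidden values and, for
each earlier `u ∈ N v`, the value `conf v u (T u)`. As the order of choice is forgotten, a pair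
`u, v` is only known to be free of conflict from the side of whichever came later. -/
theorem exists_greedy_choice {V ι : Type*} [DecidableEq V] [DecidableEq ι] [Inhabited ι]
    (P : Finset V) (avail forb : V → Finset ι) (N : V → Finset V) (conf : V → V → ι → ι)
    (hcard : ∀ v ∈ P, (forb v).card + (N v).card < (avail v).card) :
    ∃ T : V → ι, ∀ v ∈ P, T v ∈ avail v ∧ T v ∉ forb v ∧ ∀ u ∈ P, u ≠ v →
      (u ∈ N v → T v ≠ conf v u (T u)) ∨ (v ∈ N u → T u ≠ conf u v (T v)) := by
  induction P using Finset.induction_on with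
  | empty => exact ⟨fun _ => default, by simp⟩
  | insert a P ha ih =>
    obtain ⟨T, hT⟩ := ih fun v hv => hcard v (Finset.mem_insert_of_mem hv)
    obtain ⟨t, hta, htf⟩ : ∃ t ∈ avail a,
        t ∉ forb a ∪ (N a).image (fun u => conf a u (T u)) := by
      apply Finset.exists_mem_notMem_of_card_lt_card
      calc _ ≤ _ := Finset.card_union_le _ _
        _ ≤ (forb a).card + (N a).card := by gcongr; exact Finset.card_image_le
        _ < _ := hcard a (Finset.mem_insert_self _ _)
    simp only [Finset.mem_union, Finset.mem_image, not_or, not_exists, not_and] at htf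
    have hne : ∀ {v}, v ∈ P → v ≠ a := fun hv h => ha (h ▸ hv)
    refine ⟨Function.update T a t, fun v hv => ?_⟩
    rcases Finset.mem_insert.1 hv with rfl | hv
    · refine ⟨by simpa using hta, by simpa using htf.1, fun u hu huv => Or.inl fun huN => ?_⟩
      simpa [Function.update_of_ne huv] using Ne.symm (htf.2 u huN)
    · obtain ⟨h1, h2, h3⟩ := hT v hv
      rw [Function.update_of_ne (hne hv)]
      refine ⟨h1, h2, fun u hu huv => ?_⟩
      rcases Finset.mem_insert.1 hu with rfl | hu
      · refine Or.inr fun hvN => ?_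
        simpa using Ne.symm (htf.2 v hvN)
      · rw [Function.update_of_ne (hne hu)]
        exact h3 u hu huv

/-! ### Separating vertices by deleting owned edges -/

/-- The graph left after removing all edges at vertices of `B`, except those that join a vertex
outside `B` of some color `i` to a vertex of `B` of color `i + 1`. -/
def pruneAt {V : Type*} (G : SimpleGraph V) (c : V → ZMod 3) (B : Finset V) :
    SimpleGraph V where
  Adj x y := G.Adj x y ∧
    ((x ∉ B ∧ y ∉ B) ∨ (x ∉ B ∧ c y = c x + 1) ∨ (y ∉ B ∧ c x = c y + 1))
  symm := ⟨fun _ _ h => ⟨h.1.symm, by tauto⟩⟩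
  loopless := ⟨fun _ h => h.1.ne rfl⟩

/-- The graph left after deleting, for every vertex `v`, the edges joining `v` to `D v`. -/
def removeArcs {V : Type*} (G : SimpleGraph V) (D : V → Finset V) : SimpleGraph V where
  Adj x y := G.Adj x y ∧ y ∉ D x ∧ x ∉ D y
  symm := ⟨fun _ _ h => ⟨h.1.symm, h.2.2, h.2.1⟩⟩
  loopless := ⟨fun _ h => h.1.ne rfl⟩

/-- Sufficient conditions for `C` to be an identifying code once every `v` has kept, among its edges
to `S v`, exactly those to `T v`. In `hsame` the trace of the second vertex already reflects that
vertex's own deletions; in `hnext` deletions play no role, since `x` and `S v` have the same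
color. -/
theorem isIdentifyingCode_removeArcs {V : Type*} [DecidableEq V] (H : SimpleGraph V)
    (c : V → ZMod 3) (C B : Finset V) (S T : V → Finset V)
    (hBC : B ⊆ C)
    (hS : ∀ v, ∀ w ∈ S v, H.Adj v w ∧ w ∈ C ∧ c w = c v + 1)
    (hHB : ∀ b ∈ B, ∀ v, H.Adj v b → v ∉ B ∧ c b = c v + 1)
    (hTS : ∀ v ∉ B, T v ⊆ S v) (hT : ∀ v ∉ B, (T v).Nonempty)
    (hnext : ∀ v ∉ B, ∀ x, c x = c v + 1 → ∃ w ∈ S v, ¬ (w ∈ T v ↔ x = w ∨ H.Adj x w))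
    (hsame : ∀ v ∉ B, ∀ u ∉ B, u ≠ v → c u = c v →
      (∃ w ∈ S v, ¬ (w ∈ T v ↔ H.Adj u w ∧ w ∉ S u \ T u)) ∨
      (∃ w ∈ S u, ¬ (w ∈ T u ↔ H.Adj v w ∧ w ∉ S v \ T v))) :
    (H.removeArcs fun v => S v \ T v).IsIdentifyingCode (C : Set V) := by
  set K := H.removeArcs fun v => S v \ T v with hK
  have three : ∀ a : ZMod 3, a ≠ a + 1 ∧ a ≠ a + 1 + 1 := by decide
  have hKadj : ∀ x y, K.Adj x y ↔ H.Adj x y ∧ y ∉ S x \ T x ∧ x ∉ S y \ T y := fun _ _ => Iff.rfl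
  -- the end `w ∈ S v` cannot own the edge `v w`: that would need `c v = c v + 2`
  have hown : ∀ v, ∀ w ∈ S v, (K.Adj v w ↔ w ∈ T v) := by
    intro v w hw
    obtain ⟨h1, -, h3⟩ := hS v w hw
    have : v ∉ S w := fun h => (three (c v)).2 (by rw [← h3]; exact (hS w v h).2.2)
    simp [hKadj, h1, hw, this]
  have hpre : ∀ u v, c u = c v → ∀ w ∈ S v,
      (K.Adj u w ↔ H.Adj u w ∧ w ∉ S u \ T u) := by
    intro u v huv w hw
    have h3 := (hS v w hw).2.2
    have : u ∉ S w := fun h =>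
      (three (c v)).2 (by rw [← h3, ← huv]; exact (hS w u h).2.2)
    simp [hKadj, this]
  have hin : ∀ x w, c x = c w → (K.Adj x w ↔ H.Adj x w) := by
    intro x w h
    have h1 : w ∉ S x := fun hw => (three (c x)).1 (by rw [← (hS x w hw).2.2, h])
    have h2 : x ∉ S w := fun hw => (three (c w)).1 (by rw [← (hS w x hw).2.2, h])
    simp [hKadj, h1, h2]
  have hmem : ∀ x w, w ∈ C → (w ∈ K.closedNbhd x ∩ (C : Set V) ↔ x = w ∨ K.Adj x w) := by
    intro x w hw
    simp [closedNbhd, hw, eq_comm]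
  have hneS : ∀ u v, c u = c v → ∀ w ∈ S v, u ≠ w := by
    rintro u v huv w hw rfl
    exact (three (c v)).1 (by rw [← (hS v u hw).2.2, huv])
  have sep_next : ∀ x, ∀ y ∉ B, c x = c y + 1 →
      K.closedNbhd x ∩ (C : Set V) ≠ K.closedNbhd y ∩ (C : Set V) := by
    intro x y hy hxy heq
    obtain ⟨w, hw, hne⟩ := hnext y hy x hxy
    obtain ⟨-, hwC, hwc⟩ := hS y w hw
    apply hne
    rw [← hown y w hw, ← hin x w (hxy.trans hwc.symm), ← hmem x w hwC, heq, hmem y w hwC]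
    simp [hneS y y rfl w hw]
  -- a vertex other than `x` whose trace contains `x ∈ B` is a good vertex of the preceding color
  have sep_B : ∀ x ∈ B, ∀ y, x ≠ y →
      K.closedNbhd x ∩ (C : Set V) ≠ K.closedNbhd y ∩ (C : Set V) := by
    intro x hx y hxy heq
    have h1 := (hmem x x (hBC hx)).2 (Or.inl rfl)
    rw [heq, hmem y x (hBC hx)] at h1
    obtain ⟨hy, hc⟩ := hHB x hx y ((h1.resolve_left hxy.symm).1)
    exact sep_next x y hy hc heq
  have sep_half : ∀ u v, c u = c v → (∃ w ∈ S v, ¬ (w ∈ T v ↔ H.Adj u w ∧ w ∉ S u \ T u)) →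
      K.closedNbhd u ∩ (C : Set V) ≠ K.closedNbhd v ∩ (C : Set V) := by
    rintro u v huv ⟨w, hw, hne⟩ heq
    apply hne
    have hwC := (hS v w hw).2.1
    have h1 := hmem u w hwC
    rw [heq, hmem v w hwC] at h1
    simp only [hneS u v huv w hw, hneS v v rfl w hw, false_or] at h1
    rw [← hown v w hw, h1, hpre u v huv w hw]
  refine ⟨fun v hv => ?_, fun u v huv => ?_⟩
  · have hvB : v ∉ B := fun h => hv (hBC h)
    obtain ⟨w, hw⟩ := hT v hvB
    have hwS := hTS v hvB hw
    exact ⟨w, (hS v w hwS).2.1, (hown v w hwS).2 hw⟩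
  · by_cases hu : u ∈ B
    · exact sep_B u hu v huv
    by_cases hv : v ∈ B
    · exact (sep_B v hv u huv.symm).symm
    have : ∀ a b : ZMod 3, a = b ∨ a = b + 1 ∨ b = a + 1 := by decide
    rcases this (c u) (c v) with h | h | h
    · rcases hsame v hv u hu huv h with h' | h'
      · exact sep_half u v h h'
      · exact (sep_half v u h.symm h').symm
    · exact sep_next u v hv h
    · exact (sep_next v u hu h).symm

open Classical in
theorem card_filter_adj_le {V : Type*} [Fintype V] (G H : SimpleGraph V)
    [DecidableRel G.Adj] (hHG : H ≤ G) (S : Finset V) :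
    (Finset.univ.filter fun x => ∃ w ∈ S, H.Adj x w).card ≤ S.card * G.maxDegree := by
  calc _ ≤ (S.biUnion fun w => G.neighborFinset w).card := by
        apply Finset.card_le_card
        intro x hx
        obtain ⟨w, hw, h⟩ := (Finset.mem_filter.1 hx).2
        exact Finset.mem_biUnion.2 ⟨w, hw, by simpa using (hHG h).symm⟩
    _ ≤ S.card * G.maxDegree :=
        Finset.card_biUnion_le_card_mul _ _ _ fun w _ => by
          simpa using G.degree_le_maxDegree w

open Classical in
/-- Deterministic part of the argument: the vertices of `B`, which lack code neighbors in the next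
color, are put into the code at the price of deleting edges at them; the others delete at most `k`
owned edges each. -/
theorem exists_deleteEdges_isIdentifyingCode {V : Type*} [Fintype V] (G : SimpleGraph V)
    [DecidableRel G.Adj] (c : V → ZMod 3) (C B : Finset V) (k : ℕ)
    (hk : 2 * (k * (G.maxDegree + 1)) + 1 < 2 ^ k)
    (hB : ∀ v ∉ B, k ≤ ((G.neighborFinset v).filter fun w => w ∈ C ∧ c w = c v + 1).card) :
    ∃ F : Finset (Sym2 V), (F : Set (Sym2 V)) ⊆ G.edgeSet ∧
      F.card ≤ B.card * G.maxDegree + Fintype.card V * k ∧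
      (G.deleteEdges (F : Set (Sym2 V))).IsIdentifyingCode ((C ∪ B : Finset V) : Set V) := by
  have hS : ∀ v, ∃ S : Finset V, (v ∈ B → S = ∅) ∧ S.card ≤ k ∧ (v ∉ B → S.card = k) ∧
      ∀ w ∈ S, G.Adj v w ∧ w ∈ C ∧ c w = c v + 1 := by
    intro v
    by_cases hv : v ∈ B
    · exact ⟨∅, by simp [hv]⟩
    · obtain ⟨S, hS, hSk⟩ := Finset.exists_subset_card_eq (hB v hv)
      refine ⟨S, by simp [hv], hSk.le, fun _ => hSk, fun w hw => ?_⟩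
      simpa using hS hw
  choose S hSB hSk hSk' hS using hS
  set H := G.pruneAt c B with hH
  have hHG : H ≤ G := fun x y h => h.1
  have hSH : ∀ v, ∀ w ∈ S v, H.Adj v w := by
    intro v w hw
    have hv : v ∉ B := fun h => by simp [hSB v h] at hw
    exact ⟨(hS v w hw).1, Or.inr (Or.inl ⟨hv, (hS v w hw).2.2⟩)⟩
  have hcard := fun v => card_filter_adj_le G H hHG (S v)
  -- `N v`: the vertices adjacent to `S v`; no other vertex outside `S v` has a nonempty trace on it
  let N : V → Finset V := fun v => Finset.univ.filter fun x => ∃ w ∈ S v, H.Adj x w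
  let forb : V → Finset (Finset V) := fun v =>
    insert ∅ ((N v ∪ S v).image fun x => (S v).filter fun w => x = w ∨ H.Adj x w)
  obtain ⟨T, hT⟩ := exists_greedy_choice (Finset.univ.filter (· ∉ B)) (fun v => (S v).powerset)
    forb N (fun v u t => (S v).filter fun w => H.Adj u w ∧ w ∉ S u \ t) (by
      intro v hv
      have hv : v ∉ B := by simpa using hv
      have h1 : (N v).card ≤ k * G.maxDegree := by simpa [N, hSk' v hv] using hcard v
      have h2 : (forb v).card ≤ k * G.maxDegree + k + 1 := by
        refine (Finset.card_insert_le _ _).trans (Nat.succ_le_succ ?_)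
        refine Finset.card_image_le.trans ((Finset.card_union_le _ _).trans ?_)
        rw [hSk' v hv]; omega
      rw [Finset.card_powerset, hSk' v hv]
      refine lt_of_le_of_lt (add_le_add h2 h1) (lt_of_le_of_lt ?_ hk)
      nlinarith)
  replace hT : ∀ v ∉ B, T v ∈ (S v).powerset ∧ T v ∉ forb v ∧ ∀ u ∉ B, u ≠ v →
      (u ∈ N v → T v ≠ (S v).filter fun w => H.Adj u w ∧ w ∉ S u \ T u) ∨
      (v ∈ N u → T u ≠ (S u).filter fun w => H.Adj v w ∧ w ∉ S v \ T v) := by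
    simpa using hT
  have hTS : ∀ v ∉ B, T v ⊆ S v := fun v hv => Finset.mem_powerset.1 (hT v hv).1
  have hT0 : ∀ v ∉ B, T v ≠ ∅ := fun v hv h => (hT v hv).2.1 (by simp [forb, h])
  -- a subset of `S v` differing from a filtered one disagrees with it at some vertex of `S v`
  have hdiff : ∀ v ∉ B, ∀ (p : V → Prop) [DecidablePred p],
      T v ≠ (S v).filter p → ∃ w ∈ S v, ¬ (w ∈ T v ↔ p w) := by
    intro v hv p _ hne
    by_contra! h
    apply hne
    ext w
    rw [Finset.mem_filter]
    exact ⟨fun hw => ⟨hTS v hv hw, (h w (hTS v hv hw)).1 hw⟩, fun hw => (h w hw.1).2 hw.2⟩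
  have hhalf : ∀ v ∉ B, ∀ u,
      (u ∈ N v → T v ≠ (S v).filter fun w => H.Adj u w ∧ w ∉ S u \ T u) →
      ∃ w ∈ S v, ¬ (w ∈ T v ↔ H.Adj u w ∧ w ∉ S u \ T u) := by
    intro v hv u h
    refine hdiff v hv _ ?_
    by_cases hu : u ∈ N v
    · exact h hu
    · intro heq
      apply hT0 v hv
      rw [heq, Finset.filter_eq_empty_iff]
      intro w hw hw'
      exact hu (by simpa [N] using ⟨w, hw, hw'.1⟩)
  have hcode := isIdentifyingCode_removeArcs H c (C ∪ B) B S T Finset.subset_union_right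
    (fun v w hw => ⟨hSH v w hw, Finset.mem_union_left _ (hS v w hw).2.1, (hS v w hw).2.2⟩)
    (fun b hb v h => by
      have := h.2
      simpa [hb] using this)
    hTS (fun v hv => Finset.nonempty_iff_ne_empty.2 (hT0 v hv))
    (fun v hv x _ => by
      refine hdiff v hv _ ?_
      by_cases hx : x ∈ N v ∪ S v
      · intro heq
        exact (hT v hv).2.1 (Finset.mem_insert_of_mem (Finset.mem_image.2 ⟨x, hx, heq.symm⟩))
      · intro heq
        apply hT0 v hv
        rw [heq, Finset.filter_eq_empty_iff]
        rintro w hw (rfl | hw')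
        · exact hx (Finset.mem_union_right _ hw)
        · exact hx (Finset.mem_union_left _ (by simpa [N] using ⟨w, hw, hw'⟩)))
    (fun v hv u hu huv _ => ((hT v hv).2.2 u hu huv).imp (hhalf v hv u) (hhalf u hu v))
  set K := H.removeArcs fun v => S v \ T v with hK
  have hKG : K ≤ G := fun x y h => h.1.1
  refine ⟨G.edgeFinset \ K.edgeFinset, by simp, ?_, ?_⟩
  · have hsub : G.edgeFinset \ K.edgeFinset ⊆ (B.biUnion fun b => G.incidenceFinset b) ∪
        Finset.univ.biUnion fun v => (S v).image fun w => s(v, w) := by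
      intro e
      induction e with | _ x y => ?_
      simp only [Finset.mem_sdiff, mem_edgeFinset, mem_edgeSet, Finset.mem_union,
        Finset.mem_biUnion, mem_incidenceFinset, Finset.mem_univ, true_and, Finset.mem_image]
      rintro ⟨hG, hnK⟩
      by_cases hx : x ∈ B
      · exact Or.inl ⟨x, hx, by simpa [incidenceSet] using hG⟩
      by_cases hy : y ∈ B
      · exact Or.inl ⟨y, hy, by simpa [incidenceSet] using hG⟩
      have hHxy : H.Adj x y := ⟨hG, Or.inl ⟨hx, hy⟩⟩
      right
      by_cases h1 : y ∈ S x \ T x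
      · exact ⟨x, y, (Finset.mem_sdiff.1 h1).1, rfl⟩
      by_cases h2 : x ∈ S y \ T y
      · exact ⟨y, x, (Finset.mem_sdiff.1 h2).1, Sym2.eq_swap⟩
      exact absurd ⟨hHxy, h1, h2⟩ hnK
    refine (Finset.card_le_card hsub).trans ((Finset.card_union_le _ _).trans (add_le_add ?_ ?_))
    · exact Finset.card_biUnion_le_card_mul _ _ _ fun b _ => by
        simpa using G.degree_le_maxDegree b
    · exact Finset.card_biUnion_le_card_mul _ _ _ fun v _ => Finset.card_image_le.trans (hSk v)
  · have : G.deleteEdges ((G.edgeFinset \ K.edgeFinset : Finset (Sym2 V)) : Set (Sym2 V)) = K := by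
      ext x y
      have := @hKG x y
      simp only [deleteEdges_adj, Finset.coe_sdiff, coe_edgeFinset, Set.mem_sdiff, mem_edgeSet]
      tauto
    rw [this]
    exact hcode

/-! ### The random coloring and code -/

open Classical in
/-- Random choice of the colors and the code, with code probability `p`. The set `B` collects the
vertices with fewer than `k` code neighbors in some color; asking this of all three colors, and not
only of the color following that of `v`, makes the event independent of the choice made at `v`. -/
theorem exists_coloring_code {V : Type*} [Fintype V] (G : SimpleGraph V) [DecidableRel G.Adj]
    (p M : ℝ) (hp0 : 0 ≤ p) (hp1 : p ≤ 1) (hM : 0 ≤ M) (k : ℕ) :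
    ∃ (c : V → ZMod 3) (C B : Finset V),
      (∀ v ∉ B, ∀ i, k ≤ ((G.neighborFinset v).filter fun w => w ∈ C ∧ c w = i).card) ∧
      C.card + M * B.card ≤ p * Fintype.card V +
        3 * Fintype.card V * M * 2 ^ k * (1 - p / 6) ^ G.minDegree := by
  let w : ZMod 3 × Bool → ℝ := fun a => 1 / 3 * if a.2 then p else 1 - p
  have hw : ∀ a, 0 ≤ w a := by
    rintro ⟨i, b⟩
    cases b <;> simp [w, hp0, hp1]
  have hw1 : ∑ a, w a = 1 := by
    simp [w, Fintype.sum_prod_type, ZMod.card]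
  let g : V ⊕ V × ZMod 3 → V → ZMod 3 × Bool → ℝ := fun j v a =>
    match j with
    | .inl u => if v = u then (if a.2 then 1 else 0) else 1
    | .inr (u, i) => if G.Adj u v then (if a = (i, true) then 1 / 2 else 1) else 1
  let κ : V ⊕ V × ZMod 3 → ℝ := fun j =>
    match j with
    | .inl _ => 1
    | .inr _ => M * 2 ^ k
  -- the summands indexed by `V` add up to `|C|`; the one at `(u, i)` is `M 2 ^ (k - X u i)`, which
  -- is at least `M` when `u` has `X u i < k` code neighbors of color `i`
  obtain ⟨f, hf⟩ := exists_sum_prod_le (V := V) w hw hw1 κ g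
  have hr0 : 0 ≤ 1 - p / 6 := by linarith
  have hr1 : 1 - p / 6 ≤ 1 := by linarith
  have hE1 : ∀ u : V, ∏ v, ∑ a, w a * g (.inl u) v a = p := by
    intro u
    rw [Finset.prod_eq_single u]
    · simp [g, w, Fintype.sum_prod_type, ZMod.card]
    · intro v _ hv
      simp [g, hv, hw1]
    · simp
  have hE2 : ∀ (u : V) (i : ZMod 3),
      ∏ v, ∑ a, w a * g (.inr (u, i)) v a ≤ (1 - p / 6) ^ G.minDegree := by
    intro u i
    have h1 : ∑ a, w a * (if a = (i, true) then 1 / 2 else 1) = 1 - p / 6 := by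
      have : ∀ a, w a * (if a = (i, true) then (1 / 2 : ℝ) else 1)
          = w a - (if a = (i, true) then w a / 2 else 0) := by
        intro a; split_ifs <;> ring
      simp_rw [this, Finset.sum_sub_distrib, hw1]
      simp [w]; ring
    have h2 : ∀ v, ∑ a, w a * g (.inr (u, i)) v a = if G.Adj u v then 1 - p / 6 else 1 := by
      intro v
      by_cases h : G.Adj u v
      · simp only [g, h, if_true, h1]
      · simp [g, h, hw1]
    simp_rw [h2]
    rw [← Finset.prod_filter, Finset.prod_const, ← neighborFinset_eq_filter]
    exact pow_le_pow_of_le_one hr0 hr1 (G.minDegree_le_degree u)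
  let C : Finset V := Finset.univ.filter fun v => (f v).2
  let X : V → ZMod 3 → ℕ := fun v i =>
    ((G.neighborFinset v).filter fun w => w ∈ C ∧ (f w).1 = i).card
  let B : Finset V := Finset.univ.filter fun v => ∃ i, X v i < k
  have hF1 : ∀ u : V, ∏ v, g (.inl u) v (f v) = if u ∈ C then 1 else 0 := by
    intro u
    rw [Finset.prod_eq_single u]
    · simp [g, C]
    · intro v _ hv
      simp [g, hv]
    · simp
  have hF2 : ∀ (u : V) (i : ZMod 3), ∏ v, g (.inr (u, i)) v (f v) = (1 / 2) ^ X u i := by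
    intro u i
    simp only [g, X]
    rw [← Finset.prod_filter, ← Finset.prod_filter, Finset.prod_const,
      ← neighborFinset_eq_filter]
    congr 2
    ext v
    simp [C, Prod.ext_iff, and_comm]
  refine ⟨fun v => (f v).1, C, B, fun v hv i => ?_, ?_⟩
  · by_contra! h
    exact hv (Finset.mem_filter.2 ⟨Finset.mem_univ _, i, h⟩)
  rw [Fintype.sum_sum_type, Fintype.sum_sum_type, Fintype.sum_prod_type,
    Fintype.sum_prod_type] at hf
  simp only [hE1, hF1, hF2, κ, one_mul] at hf
  have hlow : M * B.card ≤ ∑ u : V, ∑ i, M * 2 ^ k * (1 / 2 : ℝ) ^ X u i := by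
    have : M * B.card = ∑ u : V, if u ∈ B then M else 0 := by
      simp [mul_comm]
    rw [this]
    refine Finset.sum_le_sum fun u _ => ?_
    have hnn : ∀ i ∈ (Finset.univ : Finset (ZMod 3)), 0 ≤ M * 2 ^ k * (1 / 2 : ℝ) ^ X u i :=
      fun i _ => by positivity
    split_ifs with hu
    · obtain ⟨i, hi⟩ := (Finset.mem_filter.1 hu).2
      refine le_trans ?_ (Finset.single_le_sum hnn (Finset.mem_univ i))
      rw [mul_assoc]
      refine le_mul_of_one_le_right hM ?_
      calc (1 : ℝ) = 2 ^ k * (1 / 2) ^ k := by rw [← mul_pow]; norm_num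
        _ ≤ 2 ^ k * (1 / 2) ^ X u i := by
          gcongr ?_ * ?_
          exact pow_le_pow_of_le_one (by norm_num) (by norm_num) hi.le
    · exact Finset.sum_nonneg hnn
  have hup : ∑ u : V, ∑ i, M * 2 ^ k * ∏ v, ∑ a, w a * g (.inr (u, i)) v a
      ≤ ∑ _u : V, ∑ _i : ZMod 3, M * 2 ^ k * (1 - p / 6) ^ G.minDegree := by
    gcongr with u _ i _
    exact hE2 u i
  have hC : ∑ u : V, (if u ∈ C then (1 : ℝ) else 0) = C.card := by simp
  rw [hC] at hf
  simp only [Finset.sum_const, Finset.card_univ, ZMod.card, nsmul_eq_mul] at hf hup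
  push_cast at hup
  nlinarith

/-! ### Numerical estimates and conclusion -/

theorem identifyingCodeNumber_eq_coe {V : Type*} {G : SimpleGraph V} {C : Finset V}
    (hC : G.IsIdentifyingCode (C : Set V)) :
    ∃ m : ℕ, G.identifyingCodeNumber = m ∧ m ≤ C.card := by
  have hle : G.identifyingCodeNumber ≤ C.card := by
    rw [← Set.encard_coe_eq_coe_finsetCard]
    exact iInf₂_le (C : Set V) hC
  obtain ⟨m, hm⟩ := ENat.ne_top_iff_exists.1 (ne_top_of_le_ne_top (ENat.natCast_ne_top _) hle)
  refine ⟨m, hm.symm, ?_⟩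
  rw [← hm] at hle
  exact_mod_cast hle

theorem eventually_log_bounds :
    ∀ᶠ x : ℝ in atTop, 3 ≤ x ∧ 1 ≤ Real.log x ∧ Real.log x ≤ x / 32 := by
  have h1 := Real.isLittleO_log_id_atTop.bound (show (0 : ℝ) < 1 / 32 by norm_num)
  filter_upwards [eventually_ge_atTop 3, Real.tendsto_log_atTop.eventually_ge_atTop 1, h1]
    with x hx hl h
  refine ⟨hx, hl, ?_⟩
  rw [Real.norm_of_nonneg (by linarith), id, Real.norm_of_nonneg (by linarith)] at h
  linarith

theorem pow_ceil_bounds {x : ℝ} (hx : 0 < x) (hl : 1 ≤ Real.log x) :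
    (⌈3 * Real.log x⌉₊ : ℝ) ≤ 4 * Real.log x ∧ x ^ 2 ≤ 2 ^ ⌈3 * Real.log x⌉₊ ∧
      (2 : ℝ) ^ ⌈3 * Real.log x⌉₊ ≤ x ^ 4 := by
  set k := ⌈3 * Real.log x⌉₊
  have h1 : 3 * Real.log x ≤ k := Nat.le_ceil _
  have h2 : (k : ℝ) < 3 * Real.log x + 1 := Nat.ceil_lt_add_one (by linarith)
  have h3 := Real.log_two_gt_d9
  have h4 := Real.log_two_lt_d9
  refine ⟨by linarith, ?_, ?_⟩ <;>
    rw [← Real.log_le_log_iff (by positivity) (by positivity), Real.log_pow, Real.log_pow] <;>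
    push_cast <;> nlinarith

end SimpleGraph

open SimpleGraph in
theorem theorem1 (ω : ℕ → ℝ) (hω : Tendsto ω atTop atTop) :
    ∃ n₀ : ℕ, ∀ n : ℕ, n₀ ≤ n →
      ∀ (V : Type*) [Fintype V] (G : SimpleGraph V) [DecidableRel G.Adj],
        Fintype.card V = n →
        ω n ≤ (G.maxDegree : ℝ) →
        66 * Real.log (G.maxDegree : ℝ) ≤ (G.minDegree : ℝ) →
        ∃ F : Finset (Sym2 V), (F : Set (Sym2 V)) ⊆ G.edgeSet ∧
          (F.card : ℝ) ≤ 83 * n * Real.log (G.maxDegree : ℝ) ∧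
          ∃ m : ℕ, (G.deleteEdges (F : Set (Sym2 V))).identifyingCodeNumber = (m : ℕ∞) ∧
            (m : ℝ) ≤ 134 * (n * Real.log (G.maxDegree : ℝ) / (G.minDegree : ℝ)) := by
  classical
  obtain ⟨x₀, hx₀⟩ := eventually_atTop.1 eventually_log_bounds
  obtain ⟨n₀, hn₀⟩ := eventually_atTop.1 (hω.eventually_ge_atTop x₀)
  refine ⟨n₀, fun n hn V _ G _ hV hΔ hδ => ?_⟩
  obtain ⟨hD3, hL1, hLD⟩ := hx₀ (G.maxDegree : ℝ) ((hn₀ n hn).trans hΔ)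
  obtain ⟨hk4, hk2, hkD⟩ := pow_ceil_bounds (by linarith) hL1
  set D : ℝ := (G.maxDegree : ℝ) with hD
  set L := Real.log D with hL
  set k := ⌈3 * L⌉₊
  set d : ℝ := (G.minDegree : ℝ) with hd
  have hd0 : 0 < d := by linarith
  have hn0 : (0 : ℝ) ≤ n := n.cast_nonneg
  have hdD : d ≤ D := by
    have : Nonempty V := by
      by_contra h
      rw [not_nonempty_iff] at h
      have : D = 0 := by simp [hD]
      linarith
    rw [hd, hD]
    exact_mod_cast G.minDegree_le_maxDegree
  have hp1 : 66 * L / d ≤ 1 := (div_le_one hd0).2 hδ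
  have hr0 : 0 ≤ 1 - 66 * L / d / 6 := by linarith
  obtain ⟨c, C, B, hB, hCB⟩ := exists_coloring_code G (66 * L / d) D (by positivity) hp1
    (by linarith) k
  rw [hV] at hCB
  -- the Chernoff estimate: `(1 - p / 6) ^ δ ≤ exp (- p δ / 6) = exp (-11 L)`
  have hexp : (1 - 66 * L / d / 6) ^ G.minDegree ≤ (D ^ 11)⁻¹ := by
    have h1 : 1 - 66 * L / d / 6 ≤ Real.exp (-(66 * L / d / 6)) := Real.one_sub_le_exp_neg _
    calc _ ≤ Real.exp (-(66 * L / d / 6)) ^ G.minDegree := by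
          gcongr
      _ = Real.exp (-L) ^ 11 := by
          rw [← Real.exp_nat_mul, ← Real.exp_nat_mul]
          congr 1
          rw [← hd]
          field_simp
          norm_num
      _ = (D ^ 11)⁻¹ := by rw [Real.exp_neg, hL, Real.exp_log (by linarith), inv_pow]
  have hbad : 3 * n * D * 2 ^ k * (1 - 66 * L / d / 6) ^ G.minDegree ≤ n * L / d := by
    calc _ ≤ 3 * n * D * D ^ 4 * (D ^ 11)⁻¹ := by gcongr
      _ = n * (3 / D ^ 5) / D := by field_simp
      _ ≤ n * L / d := by
        gcongr
        refine le_trans ?_ hL1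
        rw [div_le_one (by positivity)]
        exact hD3.trans (le_self_pow₀ (by linarith) (by norm_num))
  have hsum : C.card + D * B.card ≤ 67 * (n * L / d) := by
    refine hCB.trans ((add_le_add_right hbad _).trans (le_of_eq ?_))
    ring
  have hBD : (B.card : ℝ) ≤ D * B.card := le_mul_of_one_le_left (by positivity) (by linarith)
  have hk : 2 * (k * (G.maxDegree + 1)) + 1 < 2 ^ k := by
    have : 2 * (k * (D + 1)) + 1 < 2 ^ k := by
      refine lt_of_lt_of_le ?_ hk2
      nlinarith
    rw [hD] at this
    exact_mod_cast this
  obtain ⟨F, hFG, hF, hcode⟩ := exists_deleteEdges_isIdentifyingCode G c C B k hk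
    fun v hv => hB v hv _
  obtain ⟨m, hm, hmC⟩ := identifyingCodeNumber_eq_coe hcode
  refine ⟨F, hFG, ?_, m, hm, ?_⟩
  · have h1 : (F.card : ℝ) ≤ B.card * D + n * k := by
      rw [hV] at hF
      rw [hD]
      exact_mod_cast hF
    have h2 : (n : ℝ) * L / d ≤ n * L := div_le_self (by positivity) (by linarith)
    have h3 : (n : ℝ) * k ≤ n * (4 * L) := by gcongr
    have h4 : (0 : ℝ) ≤ C.card := by positivity
    have h5 : 0 ≤ (n : ℝ) * L := by positivity
    linarith
  · have h1 : (m : ℝ) ≤ C.card + B.card := by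
      exact_mod_cast hmC.trans (Finset.card_union_le _ _)
    have h2 : 0 ≤ (n : ℝ) * L / d := by positivity
    linarith
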